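/- Let $K$ be a field of characteristic $0$ and consider symmetric functions over $K$ in countably many variables $x_1,x_2,\ldots$. For a partition $\mu$, let $S_\mu=\sum_T x^T$ be the Schur function, where the sum is over all semistandard Young tableaux $T$ of shape $\mu$ and $x^T$ is the monomial in which the exponent of $x_i$ is the number of entries $i$ in $T$. For $n\ge 1$ let $$k_n=\sum_{\substack{a+b=n\\ a\ge 1,\ b\ge 0}} S_{(a,1^b)}.$$ Let $p_m=\sum_i x_i^m$ for $m\ge 1$, and for a partition $\lambda=(\lambda_1,\ldots,\lambda_\ell)$ with exactly $\ell=\ell(\lambda)$ (positive) parts let $p_\lambda=p_{\lambda_1}\cdots p_{\lambda_\ell}$ and $z_\lambda=\prod_{i\ge 1} i^{m_i}\,m_i!$, where $m_i$ is the number of parts of $\lambda$ equal to $i$. Then for each $n\ge 1$, $$k_n=\sum_{\lambda} 2^{\ell(\lambda)-1}z_\lambda^{-1}p_\lambda,$$ where the sum is over all partitions $\lambda$ of $n$ all of whose parts are odd. -/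

import Mathlib

namespace DoublySymmetric

open Finset

/-- The power sum symmetric function `p_n = ∑ i, x_i ^ n` for `n ≥ 1`, in countably many variables
`x_0, x_1, x_2, …`, as a formal power series: the monomials occurring in it are exactly
the `x_i ^ n`, each with coefficient `1`. (The index `n = 0` is never used.) -/
noncomputable def powerSum (K : Type*) [Field K] (n : ℕ) : MvPowerSeries ℕ K :=
  open Classical in
  fun d => if ∃ i : ℕ, d = Finsupp.single i n then 1 else 0

/-- `p_λ = p_{λ_1} p_{λ_2} ⋯ p_{λ_m}` for a partition `λ` with parts `λ_1, …, λ_m`. -/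
noncomputable def powerSumPart (K : Type*) [Field K] {n : ℕ} (lam : n.Partition) :
    MvPowerSeries ℕ K :=
  (lam.parts.map (powerSum K)).prod

/-- The semistandard tableau `T` has content `d`: each letter `i` occurs exactly `d i` times
in `T`, i.e. the monomial `x ^ T` is `∏ i, x_i ^ (d i)`. -/
def HasContent {μ : YoungDiagram} (T : SemistandardYoungTableau μ) (d : ℕ →₀ ℕ) : Prop :=
  ∀ i : ℕ, #{c ∈ μ.cells | T c.1 c.2 = i} = d i

/-- The Schur function `S_μ = ∑ T, x ^ T`, the sum being over all semistandard Young tableaux of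
shape `μ`, as a formal power series in countably many variables: the coefficient of a monomial
is the (finite) number of semistandard tableaux of shape `μ` with that content. -/
noncomputable def schur (K : Type*) [Field K] (μ : YoungDiagram) : MvPowerSeries ℕ K :=
  fun d => (Nat.card {T : SemistandardYoungTableau μ // HasContent T d} : K)

/-- The partition `(a, 1 ^ b)` with `a ≥ 1`: a row of length `a` followed by `b` rows of
length `1`. -/
def hook (a b : ℕ) (ha : 1 ≤ a) : YoungDiagram :=
  YoungDiagram.ofRowLens (a :: List.replicate b 1) (by
    rw [List.sortedGE_iff_pairwise, List.pairwise_cons]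
    refine ⟨fun x hx => ?_, ?_⟩
    · rw [List.eq_of_mem_replicate hx]
      exact ha
    · simp [List.pairwise_replicate])

/-- `k_n = ∑_{a + b = n} S_{(a, 1 ^ b)}`, the sum being over all `a ≥ 1`, `b ≥ 0` with
`a + b = n`. -/
noncomputable def kFun (K : Type*) [Field K] (n : ℕ) : MvPowerSeries ℕ K :=
  ∑ q ∈ antidiagonal n, if ha : 1 ≤ q.1 then schur K (hook q.1 q.2 ha) else 0

/-- `z_λ = ∏ i, i ^ (m_i) * (m_i)!`, where `m_i` is the number of parts of `λ` equal to `i`. -/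
def zPart {n : ℕ} (lam : n.Partition) : ℕ :=
  ∏ i ∈ lam.parts.toFinset, i ^ lam.parts.count i * (lam.parts.count i).factorial

end DoublySymmetric

namespace DoublySymmetric

open Finset

/-! ### Power sums: the recursion for the expansion over odd partitions -/

section PowerSums

variable (K : Type*) [Field K]

/-! After doubling, both sides equal q_n, the degree n part of ∏ (1 + x_i)/(1 - x_i), in which a
monomial with s distinct variables has coefficient 2 ^ s (`supportSeries`). For hooks, fix a content
with s distinct letters. The corner must hold the least letter, and the leg can be any b of the
other s - 1 letters, so there are C(s - 1, b) tableaux (`card_hook_tableaux`); summing over b gives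
2 ^ (s - 1). For power sums, logarithmic differentiation of the product suggests n q_n = 2 ∑ p_m
q_{n-m} over odd m, which is checked on coefficients (`natCast_mul_supportSeries`). Removing one
part from a partition shows that ∑ 2 ^ ℓ(λ) z_λ⁻¹ p_λ satisfies the same recursion
(`natCast_smul_sum_oddTerm`). In characteristic 0 the recursion and the value at n = 0 determine the
sequence. -/

theorem coeff_powerSum_mul {m : ℕ} (hm : m ≠ 0) (q : MvPowerSeries ℕ K) (d : ℕ →₀ ℕ) :
    MvPowerSeries.coeff d (powerSum K m * q) =
      ∑ i ∈ d.support, if m ≤ d i then MvPowerSeries.coeff (d - Finsupp.single i m) q else 0 := by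
  classical
  rw [MvPowerSeries.coeff_mul, ← Finset.sum_filter]
  have h1 : ∀ e, MvPowerSeries.coeff e (powerSum K m) =
      if ∃ i : ℕ, e = Finsupp.single i m then 1 else 0 := by
    intro e
    simp only [MvPowerSeries.coeff_apply, powerSum]
  simp only [h1, ite_mul, one_mul, zero_mul]
  rw [← Finset.sum_filter]
  symm
  refine Finset.sum_bij (fun i _ => (Finsupp.single i m, d - Finsupp.single i m)) ?_ ?_ ?_ ?_
  · intro i hi
    simp only [mem_filter, Finsupp.mem_support_iff, Finset.HasAntidiagonal.mem_antidiagonal] at hi ⊢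
    exact ⟨add_tsub_cancel_of_le (Finsupp.single_le_iff.2 hi.2), i, rfl⟩
  · intro i _ j _ h
    exact Finsupp.single_left_injective hm (Prod.ext_iff.1 h).1
  · rintro ⟨e, f⟩ h
    simp only [mem_filter, Finset.HasAntidiagonal.mem_antidiagonal] at h
    obtain ⟨h, i, rfl⟩ := h
    have hi : m ≤ d i := by simp [← h]
    refine ⟨i, ?_, ?_⟩
    · simp only [mem_filter, Finsupp.mem_support_iff]
      exact ⟨by omega, hi⟩
    · simp [← h]
  · intros
    rfl

/-- The degree `n` part of `∏ i, (1 + x_i) / (1 - x_i)`. -/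
noncomputable def supportSeries (n : ℕ) : MvPowerSeries ℕ K :=
  fun d => if d.degree = n then 2 ^ #d.support else 0

theorem coeff_supportSeries (n : ℕ) (d : ℕ →₀ ℕ) :
    MvPowerSeries.coeff d (supportSeries K n) = if d.degree = n then 2 ^ #d.support else 0 :=
  rfl

theorem supportSeries_zero : supportSeries K 0 = 1 := by
  classical
  ext d
  rw [coeff_supportSeries, MvPowerSeries.coeff_one]
  by_cases h : d = 0 <;> simp [h, Finsupp.degree_eq_zero_iff]

theorem sum_range_odd (k : ℕ) :
    (∑ m ∈ range k, if Odd m then 2 else 0) + (if Odd k then 1 else 0) = k := by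
  induction k with
  | zero => simp
  | succ k ih =>
    rw [Finset.sum_range_succ]
    by_cases h : Odd k
    · simp only [h, if_true, Nat.odd_add_one, not_true, if_false] at ih ⊢
      omega
    · simp only [h, if_false, Nat.odd_add_one, not_false_iff, if_true] at ih ⊢
      omega

theorem card_support_sub_single {d : ℕ →₀ ℕ} {i m : ℕ} (hm : m < d i) :
    #(d - Finsupp.single i m).support = #d.support := by
  congr 1
  ext j
  by_cases h : j = i
  · subst h
    simp
    omega
  · simp [Ne.symm h]

theorem card_support_sub_single_self {d : ℕ →₀ ℕ} {i : ℕ} (hi : i ∈ d.support) :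
    #(d - Finsupp.single i (d i)).support + 1 = #d.support := by
  rw [← Finset.card_erase_add_one hi]
  congr 2
  ext j
  by_cases h : j = i
  · subst h
    simp
  · simp [h]

/-- Removing fewer than `d i` copies of `i` keeps the support, so each odd m < d i contributes 2 · 2
^ s. Removing all of them loses `i`, so m = d i contributes half as much, if odd. `sum_range_odd` is
this weighted count. -/
theorem sum_odd_two_mul_pow_card_support {d : ℕ →₀ ℕ} {i n : ℕ} (hi : i ∈ d.support)
    (hn : d i ≤ n) :
    (∑ m ∈ range (n + 1), if Odd m then
      (if m ≤ d i then 2 * 2 ^ #(d - Finsupp.single i m).support else 0) else 0) =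
      d i * 2 ^ #d.support := by
  have hsub : range (d i + 1) ⊆ range (n + 1) := Finset.range_mono (by omega)
  rw [← Finset.sum_subset hsub, Finset.sum_range_succ]
  · conv_rhs => rw [← sum_range_odd (d i)]
    rw [add_mul, Finset.sum_mul]
    congr 1
    · refine Finset.sum_congr rfl fun m hm => ?_
      have hm := Finset.mem_range.1 hm
      simp only [card_support_sub_single hm, hm.le, if_true, ite_mul, zero_mul]
    · rw [← card_support_sub_single_self hi]
      simp [pow_succ, mul_comm]
  · intro m _ hm
    have : ¬ m ≤ d i := by simpa using hm
    simp [this]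

theorem degree_sub_single {d : ℕ →₀ ℕ} {i m : ℕ} (h : m ≤ d i) :
    (d - Finsupp.single i m).degree + m = d.degree := by
  conv_rhs => rw [← tsub_add_cancel_of_le (Finsupp.single_le_iff.2 h)]
  simp

/-- At a monomial `d` of degree n, the terms that remove powers of x_i add up to d_i · 2 ^ s, and ∑
d_i = n. -/
theorem natCast_mul_supportSeries (n : ℕ) :
    (n : K) • supportSeries K n =
      ∑ m ∈ range (n + 1), if Odd m then (2 : K) • (powerSum K m * supportSeries K (n - m))
        else 0 := by
  ext d
  have hR : ∀ m ∈ range (n + 1), MvPowerSeries.coeff d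
      (if Odd m then (2 : K) • (powerSum K m * supportSeries K (n - m)) else 0) =
      ∑ i ∈ d.support, if Odd m then (if m ≤ d i then (if d.degree = n then
        2 * 2 ^ #(d - Finsupp.single i m).support else 0) else 0) else 0 := by
    intro m hm
    have hm := Finset.mem_range.1 hm
    by_cases hodd : Odd m
    · simp only [hodd, if_true, MvPowerSeries.coeff_smul]
      rw [coeff_powerSum_mul K hodd.pos.ne', Finset.mul_sum]
      refine Finset.sum_congr rfl fun i _ => ?_
      by_cases h : m ≤ d i
      · have := degree_sub_single h
        have h2 : (d - Finsupp.single i m).degree = n - m ↔ d.degree = n := by omega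
        simp [h, coeff_supportSeries, h2]
      · simp [h]
    · simp [hodd]
  rw [map_sum, Finset.sum_congr rfl hR, Finset.sum_comm, MvPowerSeries.coeff_smul,
    coeff_supportSeries]
  by_cases hd : d.degree = n
  · simp only [hd, if_true]
    have key : ∀ i ∈ d.support, (∑ m ∈ range (n + 1), if Odd m then
        (if m ≤ d i then 2 * (2 : K) ^ #(d - Finsupp.single i m).support else 0) else 0) =
        (d i : K) * 2 ^ #d.support := by
      intro i hi
      have := sum_odd_two_mul_pow_card_support hi (hd ▸ Finsupp.le_degree i d)
      exact_mod_cast congrArg (Nat.cast (R := K)) this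
    rw [Finset.sum_congr rfl key, ← Finset.sum_mul, ← hd, Finsupp.degree_apply]
    simp
  · simp [hd]

/-- `2 ^ ℓ(λ) z_λ⁻¹ p_λ` as a function of the multiset of parts of `λ`. -/
noncomputable def oddTerm (s : Multiset ℕ) : MvPowerSeries ℕ K :=
  ((2 : K) ^ Multiset.card s *
    ((∏ i ∈ s.toFinset, i ^ s.count i * (s.count i).factorial : ℕ) : K)⁻¹) •
    (s.map (powerSum K)).prod

/-- The multisets of odd numbers with sum `n`. -/
def oddMultisets (n : ℕ) : Finset (Multiset ℕ) :=
  (Nat.Partition.odds n).image Nat.Partition.parts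

theorem mem_oddMultisets {n : ℕ} {s : Multiset ℕ} :
    s ∈ oddMultisets n ↔ s.sum = n ∧ ∀ i ∈ s, Odd i := by
  simp only [oddMultisets, Nat.Partition.odds, Nat.Partition.restricted, mem_image, mem_filter,
    mem_univ, true_and, Nat.not_even_iff_odd]
  constructor
  · rintro ⟨p, hp, rfl⟩
    exact ⟨p.parts_sum, hp⟩
  · rintro ⟨h, ho⟩
    exact ⟨⟨s, fun hi => (ho _ hi).pos, h⟩, ho, rfl⟩

theorem prod_pow_mul_factorial_cons (m : ℕ) (s : Multiset ℕ) :
    ∏ i ∈ (m ::ₘ s).toFinset, i ^ (m ::ₘ s).count i * ((m ::ₘ s).count i).factorial =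
      m * (m ::ₘ s).count m *
        ∏ i ∈ s.toFinset, i ^ s.count i * (s.count i).factorial := by
  -- If `m` is new, its factor for `s` is 1, so both products can run over the same index set.
  have h2 : ∏ i ∈ s.toFinset, i ^ s.count i * (s.count i).factorial =
      ∏ i ∈ (m ::ₘ s).toFinset, i ^ s.count i * (s.count i).factorial := by
    refine Finset.prod_subset (by simp) fun i _ hi => ?_
    have : s.count i = 0 := Multiset.count_eq_zero.2 (by simpa using hi)
    simp [this]
  have hm : m ∈ (m ::ₘ s).toFinset := by simp
  rw [h2, ← Finset.mul_prod_erase _ _ hm, ← Finset.mul_prod_erase _ _ hm, ← mul_assoc]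
  congr 1
  · rw [Multiset.count_cons_self, Nat.factorial_succ]
    ring
  · refine Finset.prod_congr rfl fun i hi => ?_
    rw [Multiset.count_cons_of_ne (Finset.ne_of_mem_erase hi)]

variable [CharZero K]

/-- Inserting a part `m` multiplies z by m times the new multiplicity of m, which the scalar on the
left cancels. -/
theorem smul_oddTerm_cons {m : ℕ} (hm : m ≠ 0) (s : Multiset ℕ) :
    ((m * (m ::ₘ s).count m : ℕ) : K) • oddTerm K (m ::ₘ s) =
      (2 : K) • (powerSum K m * oddTerm K s) := by
  have h : ((m * (m ::ₘ s).count m : ℕ) : K) ≠ 0 := by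
    exact Nat.cast_ne_zero.2 (mul_ne_zero hm (by simp))
  rw [oddTerm, oddTerm, prod_pow_mul_factorial_cons, Multiset.map_cons, Multiset.prod_cons,
    mul_smul_comm, smul_smul, smul_smul, Multiset.card_cons]
  congr 1
  rw [Nat.cast_mul (m * _), mul_inv, pow_succ, mul_comm (2 : K) (_ * _),
    mul_left_comm, mul_left_comm _ (_ : K)⁻¹, inv_mul_cancel_left₀ h]
  ring

/-- Write n as the sum of m · m_m over the distinct parts m. Pairs (multiset, chosen part)
correspond to pairs (part, remaining multiset). -/
theorem natCast_smul_sum_oddTerm (n : ℕ) :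
    (n : K) • ∑ s ∈ oddMultisets n, oddTerm K s =
      ∑ m ∈ range (n + 1), if Odd m then
        (2 : K) • (powerSum K m * ∑ s ∈ oddMultisets (n - m), oddTerm K s) else 0 := by
  have hL : (n : K) • ∑ s ∈ oddMultisets n, oddTerm K s =
      ∑ s ∈ oddMultisets n, ∑ m ∈ s.toFinset, ((m * s.count m : ℕ) : K) • oddTerm K s := by
    rw [Finset.smul_sum]
    refine Finset.sum_congr rfl fun s hs => ?_
    rw [← Finset.sum_smul, ← Nat.cast_sum, ← (mem_oddMultisets.1 hs).1,
      Finset.sum_multiset_count]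
    simp [mul_comm]
  simp only [hL, Finset.mul_sum, Finset.smul_sum]
  rw [← Finset.sum_filter, Finset.sum_sigma', Finset.sum_sigma']
  refine Finset.sum_bij' (fun x _ => ⟨x.2, x.1.erase x.2⟩) (fun x _ => ⟨x.1 ::ₘ x.2, x.1⟩)
    ?_ ?_ ?_ ?_ ?_
  · rintro ⟨s, m⟩ h
    simp only [mem_sigma, mem_oddMultisets, Multiset.mem_toFinset, mem_filter, mem_range] at h ⊢
    obtain ⟨⟨h1, h2⟩, h3⟩ := h
    have := Multiset.sum_erase h3
    exact ⟨⟨by omega, h2 m h3⟩, by omega, fun i hi => h2 i (Multiset.mem_of_mem_erase hi)⟩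
  · rintro ⟨m, s⟩ h
    simp only [mem_sigma, mem_oddMultisets, Multiset.mem_toFinset, mem_filter, mem_range] at h ⊢
    obtain ⟨⟨h1, h2⟩, h3, h4⟩ := h
    refine ⟨⟨by rw [Multiset.sum_cons]; omega, ?_⟩, by simp⟩
    intro i hi
    rcases Multiset.mem_cons.1 hi with rfl | hi
    exacts [h2, h4 i hi]
  · rintro ⟨s, m⟩ h
    simp only [mem_sigma, Multiset.mem_toFinset] at h
    simp [Multiset.cons_erase h.2]
  · rintro ⟨m, s⟩ h
    simp
  · rintro ⟨s, m⟩ h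
    simp only [mem_sigma, mem_oddMultisets, Multiset.mem_toFinset] at h
    have := smul_oddTerm_cons K (h.1.2 m h.2).pos.ne' (s.erase m)
    rwa [Multiset.cons_erase h.2] at this

theorem sum_oddTerm_eq_supportSeries (n : ℕ) :
    ∑ s ∈ oddMultisets n, oddTerm K s = supportSeries K n := by
  induction n using Nat.strong_induction_on with
  | _ n ih =>
    rcases Nat.eq_zero_or_pos n with rfl | hn
    · have : oddMultisets 0 = {0} := by
        ext s
        rw [mem_oddMultisets, Multiset.sum_eq_zero_iff, mem_singleton]
        constructor
        · rintro ⟨h1, h2⟩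
          refine Multiset.eq_zero_of_forall_notMem fun i hi => ?_
          have := (h2 i hi).pos
          have := h1 i hi
          omega
        · rintro rfl
          simp
      rw [this, supportSeries_zero]
      simp [oddTerm]
    · have hn' : (n : K) ≠ 0 := by exact_mod_cast hn.ne'
      refine smul_right_injective _ hn' ?_
      change (n : K) • _ = (n : K) • _
      rw [natCast_smul_sum_oddTerm, natCast_mul_supportSeries]
      refine Finset.sum_congr rfl fun m _ => ?_
      by_cases hm : Odd m
      · rw [ih (n - m) (by have := hm.pos; omega)]
      · simp [hm]

theorem two_smul_sum_odds {n : ℕ} (hn : 1 ≤ n) :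
    (2 : K) • ∑ lam ∈ Nat.Partition.odds n,
        ((2 : K) ^ (Multiset.card lam.parts - 1) * (zPart lam : K)⁻¹) • powerSumPart K lam =
      supportSeries K n := by
  rw [← sum_oddTerm_eq_supportSeries, oddMultisets,
    Finset.sum_image (fun _ _ _ _ h => Nat.Partition.ext h), Finset.smul_sum]
  refine Finset.sum_congr rfl fun lam _ => ?_
  -- Since n ≥ 1 there is a part, so the subtraction in ℓ - 1 does not truncate.
  have hcard : Multiset.card lam.parts ≠ 0 := by
    intro h
    have h1 := lam.parts_sum
    rw [Multiset.card_eq_zero.1 h, Multiset.sum_zero] at h1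
    omega
  rw [oddTerm, smul_smul, ← mul_assoc, mul_pow_sub_one hcard]
  rfl

end PowerSums

/-! ### Hook Schur functions: counting tableaux by their legs -/

section Hooks

theorem mem_hook {a b : ℕ} {ha : 1 ≤ a} {i j : ℕ} :
    (i, j) ∈ hook a b ha ↔ i = 0 ∧ j < a ∨ j = 0 ∧ 1 ≤ i ∧ i ≤ b := by
  rw [hook, YoungDiagram.mem_ofRowLens]
  cases i with
  | zero => simp
  | succ i =>
    simp only [List.length_cons, List.length_replicate, List.getElem_cons_succ,
      List.getElem_replicate, exists_prop]
    omega

theorem hook_cells_val {a b : ℕ} (ha : 1 ≤ a) :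
    (hook a b ha).cells.val = (Multiset.range a).map (fun j => (0, j)) +
      (Multiset.range b).map (fun i => (i + 1, 0)) := by
  refine (Multiset.Nodup.ext (Finset.nodup _) (Multiset.nodup_add.2 ⟨?_, ?_, ?_⟩)).2 ?_
  · exact (Multiset.nodup_range a).map fun _ _ h => (Prod.ext_iff.1 h).2
  · exact (Multiset.nodup_range b).map fun _ _ h => by simpa using h
  · rw [Multiset.disjoint_left]
    simp only [Multiset.mem_map]
    rintro _ ⟨j, _, rfl⟩ ⟨i, _, h⟩
    simp at h
  · rintro ⟨i, j⟩
    rw [Finset.mem_val, YoungDiagram.mem_cells, mem_hook]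
    simp only [Multiset.mem_add, Multiset.mem_map, Multiset.mem_range, Prod.mk.injEq]
    constructor
    · rintro (⟨rfl, h⟩ | ⟨rfl, h1, h2⟩)
      · exact Or.inl ⟨j, h, rfl, rfl⟩
      · exact Or.inr ⟨i - 1, by omega, by omega, rfl⟩
    · rintro (⟨k, h, rfl, rfl⟩ | ⟨k, h, rfl, rfl⟩)
      · exact Or.inl ⟨rfl, h⟩
      · exact Or.inr ⟨rfl, by omega, by omega⟩

/-- As a multiset identity, the content splits into arm plus leg, and either can be cancelled. -/
theorem hasContent_iff {μ : YoungDiagram} (T : SemistandardYoungTableau μ) (d : ℕ →₀ ℕ) :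
    HasContent T d ↔ μ.cells.val.map (fun c => T c.1 c.2) = Finsupp.toMultiset d := by
  rw [Multiset.ext]
  refine forall_congr' fun i => ?_
  rw [Multiset.count_map, Finsupp.count_toMultiset, Finset.card_def, Finset.filter_val]
  simp only [eq_comm]

/-- The first row of a tableau of hook shape `(a, 1 ^ b)`. -/
def armList (f : ℕ → ℕ → ℕ) (a : ℕ) : List ℕ := (List.range a).map fun j => f 0 j

/-- The first column, without its top cell, of a tableau of hook shape `(a, 1 ^ b)`. -/
def legList (f : ℕ → ℕ → ℕ) (b : ℕ) : List ℕ := (List.range b).map fun i => f (i + 1) 0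

theorem hasContent_hook_iff {a b : ℕ} {ha : 1 ≤ a}
    (T : SemistandardYoungTableau (hook a b ha)) (d : ℕ →₀ ℕ) :
    HasContent T d ↔
      (armList T a : Multiset ℕ) + (legList T b : Multiset ℕ) = Finsupp.toMultiset d := by
  rw [hasContent_iff, hook_cells_val, Multiset.map_add, Multiset.map_map, Multiset.map_map]
  rfl

theorem pairwise_armList {a b : ℕ} {ha : 1 ≤ a} (T : SemistandardYoungTableau (hook a b ha)) :
    (armList T a).Pairwise (· ≤ ·) := by
  rw [armList, List.pairwise_map]
  refine List.pairwise_lt_range.imp_of_mem fun {x y} _ hy hxy => ?_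
  exact T.row_weak hxy (mem_hook.2 (Or.inl ⟨rfl, List.mem_range.1 hy⟩))

theorem pairwise_legList {a b : ℕ} {ha : 1 ≤ a} (T : SemistandardYoungTableau (hook a b ha)) :
    (legList T b).Pairwise (· < ·) := by
  rw [legList, List.pairwise_map]
  refine List.pairwise_lt_range.imp_of_mem fun {x y} _ hy hxy => ?_
  have := List.mem_range.1 hy
  exact T.col_strict (by omega) (mem_hook.2 (Or.inr ⟨rfl, by omega, by omega⟩))

theorem corner_lt_of_mem_legList {a b : ℕ} {ha : 1 ≤ a}
    (T : SemistandardYoungTableau (hook a b ha)) {x : ℕ} (hx : x ∈ legList T b) : T 0 0 < x := by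
  obtain ⟨i, hi, rfl⟩ := List.mem_map.1 hx
  have := List.mem_range.1 hi
  exact T.col_strict (by omega) (mem_hook.2 (Or.inr ⟨rfl, by omega, by omega⟩))

theorem hook_tableau_ext {a b : ℕ} {ha : 1 ≤ a} {T T' : SemistandardYoungTableau (hook a b ha)}
    (h1 : armList T a = armList T' a) (h2 : legList T b = legList T' b) : T = T' := by
  refine SemistandardYoungTableau.ext fun i j => ?_
  by_cases h : (i, j) ∈ hook a b ha
  · rcases mem_hook.1 h with ⟨rfl, hj⟩ | ⟨rfl, hi, hb⟩
    · exact List.map_inj_left.1 h1 j (List.mem_range.2 hj)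
    · have := List.map_inj_left.1 h2 (i - 1) (List.mem_range.2 (by omega))
      rwa [Nat.sub_add_cancel hi] at this
  · rw [T.zeros h, T'.zeros h]

/-- The filling of a hook with first row `L` and with `M` as the rest of the first column. -/
def hookEntry (L M : List ℕ) (i j : ℕ) : ℕ :=
  if i = 0 then L.getD j 0 else if j = 0 then M.getD (i - 1) 0 else 0

theorem armList_hookEntry {L M : List ℕ} {a : ℕ} (h : L.length = a) :
    armList (hookEntry L M) a = L := by
  subst h
  refine List.ext_getElem (by simp [armList]) fun i h1 h2 => ?_
  simp [armList, hookEntry, h2]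

theorem legList_hookEntry {L M : List ℕ} {b : ℕ} (h : M.length = b) :
    legList (hookEntry L M) b = M := by
  subst h
  refine List.ext_getElem (by simp [legList]) fun i h1 h2 => ?_
  simp [legList, hookEntry, h2]

/-- The semistandard tableau of hook shape with first row `L` and with `M` as the rest of the
first column. -/
def hookTableau {L M : List ℕ} {a b : ℕ} (ha : 1 ≤ a) (hLa : L.length = a) (hMb : M.length = b)
    (hL : L.Pairwise (· ≤ ·)) (hM : M.Pairwise (· < ·)) (hLM : ∀ x ∈ M, L.getD 0 0 < x) :
    SemistandardYoungTableau (hook a b ha) where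
  entry := hookEntry L M
  row_weak' := by
    intro i j1 j2 hj h
    rcases mem_hook.1 h with ⟨rfl, hj2⟩ | ⟨rfl, _⟩
    · have h2 : j2 < L.length := by omega
      have h1 : j1 < L.length := by omega
      simpa [hookEntry, h1, h2] using List.pairwise_iff_getElem.1 hL j1 j2 h1 h2 hj
    · omega
  col_strict' := by
    intro i1 i2 j hi h
    rcases mem_hook.1 h with ⟨rfl, _⟩ | ⟨rfl, h1, h2⟩
    · omega
    · have h2' : i2 - 1 < M.length := by omega
      have e2 : hookEntry L M i2 0 = M[i2 - 1] := by
        simp [hookEntry, Nat.one_le_iff_ne_zero.1 h1, h2']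
      rw [e2]
      rcases Nat.eq_zero_or_pos i1 with rfl | hpos
      · simpa [hookEntry] using hLM _ (List.getElem_mem h2')
      · have h1' : i1 - 1 < M.length := by omega
        have e1 : hookEntry L M i1 0 = M[i1 - 1] := by
          simp [hookEntry, hpos.ne', h1']
        rw [e1]
        exact List.pairwise_iff_getElem.1 hM _ _ h1' h2' (by omega)
  zeros' := by
    intro i j h
    rw [mem_hook] at h
    unfold hookEntry
    split_ifs with h1 h2
    · exact List.getD_eq_default _ _ (by omega)
    · exact List.getD_eq_default _ _ (by omega)
    · rfl

/-- The leg is strictly increasing, so its set of entries determines it. -/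
theorem sort_toFinset_legList {a b : ℕ} {ha : 1 ≤ a}
    (T : SemistandardYoungTableau (hook a b ha)) : (legList T b).toFinset.sort = legList T b := by
  have hnd : (legList T b).Nodup := (pairwise_legList T).imp fun h => h.ne
  exact (List.toFinset_sort (· ≤ ·) hnd).2 ((pairwise_legList T).imp fun h => h.le)

theorem card_of_hasContent_hook {a b : ℕ} {ha : 1 ≤ a} {d : ℕ →₀ ℕ}
    {T : SemistandardYoungTableau (hook a b ha)} (h : HasContent T d) : a + b = d.degree := by
  have := congrArg Multiset.card ((hasContent_hook_iff T d).1 h)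
  rw [Finsupp.card_toMultiset] at this
  simpa [armList, legList, Finsupp.degree_apply, Finsupp.sum] using this

/-- Sending a tableau to its set of leg entries is a bijection onto the `b`-subsets of the support
without its minimum. The arm is then the sorted remainder of the content. -/
theorem card_hook_tableaux {a b : ℕ} (ha : 1 ≤ a) {d : ℕ →₀ ℕ} (hd : d.degree = a + b) :
    Nat.card {T : SemistandardYoungTableau (hook a b ha) // HasContent T d} =
      (#d.support - 1).choose b := by
  have hne : d.support.Nonempty := by
    rw [Finsupp.support_nonempty_iff]
    rintro rfl
    simp at hd
    omega
  set m := d.support.min' hne with hm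
  have hms : m ∈ d.support := Finset.min'_mem _ _
  have hcard : #(d.support.erase m) = #d.support - 1 := Finset.card_erase_of_mem hms
  have hleg : ∀ T : {T : SemistandardYoungTableau (hook a b ha) // HasContent T d},
      (legList T.1 b).toFinset ∈ (d.support.erase m).powersetCard b := by
    rintro ⟨T, hT⟩
    rw [hasContent_hook_iff] at hT
    rw [Finset.mem_powersetCard]
    constructor
    · intro x hx
      rw [List.mem_toFinset] at hx
      have h0 : T 0 0 ∈ d.support := by
        rw [← Finsupp.mem_toMultiset, ← hT, Multiset.mem_add]
        exact Or.inl (List.mem_map.2 ⟨0, List.mem_range.2 ha, rfl⟩)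
      have h1 := corner_lt_of_mem_legList T hx
      have h2 := Finset.min'_le _ _ h0
      rw [Finset.mem_erase]
      refine ⟨by omega, ?_⟩
      rw [← Finsupp.mem_toMultiset, ← hT, Multiset.mem_add]
      exact Or.inr hx
    · rw [List.toFinset_card_of_nodup ((pairwise_legList T).imp fun h => h.ne)]
      simp [legList]
  rw [← hcard, ← Finset.card_powersetCard, ← Nat.card_eq_finsetCard]
  refine Nat.card_congr (Equiv.ofBijective (fun T => ⟨(legList T.1 b).toFinset, hleg T⟩) ⟨?_, ?_⟩)
  · rintro ⟨T, hT⟩ ⟨T', hT'⟩ h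
    have h := congrArg Finset.sort (Subtype.ext_iff.1 h)
    simp only [sort_toFinset_legList] at h
    rw [hasContent_hook_iff] at hT hT'
    rw [← hT', h] at hT
    refine Subtype.ext (hook_tableau_ext ?_ h)
    exact (Multiset.coe_eq_coe.1 (add_right_cancel hT)).eq_of_pairwise'
      (pairwise_armList T) (pairwise_armList T')
  · rintro ⟨B, hB⟩
    obtain ⟨hBs, hBb⟩ := Finset.mem_powersetCard.1 hB
    have hle : B.val ≤ Finsupp.toMultiset d := by
      rw [Multiset.le_iff_subset B.nodup]
      intro x hx
      rw [Finsupp.mem_toMultiset]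
      exact Finset.mem_of_mem_erase (hBs hx)
    have hMb : B.sort.length = b := by rw [Finset.length_sort, hBb]
    have hLa : (Finsupp.toMultiset d - B.val).sort.length = a := by
      rw [Multiset.length_sort, Multiset.card_sub hle, Finsupp.card_toMultiset, Finset.card_val,
        hBb]
      rw [Finsupp.degree_apply] at hd
      change d.sum (fun _ => id) - b = a
      simp only [Finsupp.sum, id]
      omega
    -- `B` avoids the minimum, so all copies of it stay in the arm, and the corner is below every
    -- leg entry.
    have hmL : m ∈ (Finsupp.toMultiset d - B.val).sort := by
      rw [Multiset.mem_sort, ← Multiset.count_pos, Multiset.count_sub, Finsupp.count_toMultiset]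
      have h1 : B.val.count m = 0 :=
        Multiset.count_eq_zero.2 fun h => Finset.notMem_erase m _ (hBs h)
      have := Finsupp.mem_support_iff.1 hms
      omega
    have hL : (Finsupp.toMultiset d - B.val).sort.Pairwise (· ≤ ·) := Multiset.pairwise_sort _ _
    have hcorner : (Finsupp.toMultiset d - B.val).sort.getD 0 0 ≤ m := by
      generalize (Finsupp.toMultiset d - B.val).sort = L at hmL hL
      cases L with
      | nil => simp at hmL
      | cons y L =>
        rcases List.mem_cons.1 hmL with h | h
        · exact h.ge
        · exact (List.pairwise_cons.1 hL).1 m h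
    have hLM : ∀ x ∈ B.sort, (Finsupp.toMultiset d - B.val).sort.getD 0 0 < x := by
      intro x hx
      have hx := Finset.mem_erase.1 (hBs ((Finset.mem_sort _).1 hx))
      exact hcorner.trans_lt (lt_of_le_of_ne (Finset.min'_le _ _ hx.2) hx.1.symm)
    let T := hookTableau ha hLa hMb hL B.sortedLT_sort.pairwise hLM
    have hT1 : armList T a = (Finsupp.toMultiset d - B.val).sort :=
      armList_hookEntry hLa
    have hT2 : legList T b = B.sort :=
      legList_hookEntry hMb
    refine ⟨⟨T, ?_⟩, ?_⟩
    · rw [hasContent_hook_iff, hT1, hT2, Multiset.sort_eq, Finset.sort_eq, tsub_add_cancel_of_le hle]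
    · refine Subtype.ext ?_
      change (legList T b).toFinset = B
      rw [hT2, Finset.sort_toFinset]

variable (K : Type*) [Field K]

theorem coeff_schur_hook {a b : ℕ} (ha : 1 ≤ a) (d : ℕ →₀ ℕ) :
    MvPowerSeries.coeff d (schur K (hook a b ha)) =
      if d.degree = a + b then ((#d.support - 1).choose b : K) else 0 := by
  change ((Nat.card _ : ℕ) : K) = _
  split_ifs with h
  · rw [card_hook_tableaux ha h]
  · have : IsEmpty {T : SemistandardYoungTableau (hook a b ha) // HasContent T d} :=
      ⟨fun T => h (card_of_hasContent_hook T.2).symm⟩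
    simp

theorem card_support_le_degree (d : ℕ →₀ ℕ) : #d.support ≤ d.degree := by
  rw [Finsupp.degree_apply, Finset.card_eq_sum_ones]
  exact Finset.sum_le_sum fun i hi => Nat.one_le_iff_ne_zero.2 (Finsupp.mem_support_iff.1 hi)

theorem coeff_kFun {n : ℕ} (hn : 1 ≤ n) (d : ℕ →₀ ℕ) :
    MvPowerSeries.coeff d (kFun K n) =
      if d.degree = n then (2 : K) ^ (#d.support - 1) else 0 := by
  have hs := card_support_le_degree d
  have h : ∀ q ∈ antidiagonal n, MvPowerSeries.coeff d
      (if ha : 1 ≤ q.1 then schur K (hook q.1 q.2 ha) else 0) =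
      if d.degree = n then ((#d.support - 1).choose q.2 : K) else 0 := by
    rintro ⟨a, b⟩ hq
    have hq : a + b = n := Finset.HasAntidiagonal.mem_antidiagonal.1 hq
    by_cases ha : 1 ≤ a
    · simp only [ha, dif_pos, coeff_schur_hook, hq]
    · simp only [ha, dif_neg, not_false_iff, map_zero]
      split_ifs with hd
      -- The missing term a = 0 costs nothing: there b = n exceeds s - 1.
      · rw [Nat.choose_eq_zero_of_lt (by omega), Nat.cast_zero]
      · rfl
  rw [kFun, map_sum, Finset.sum_congr rfl h]
  split_ifs with hd
  · rw [Finset.Nat.sum_antidiagonal_eq_sum_range_succ_mk]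
    refine (Finset.sum_range_reflect
      (fun k => ((#d.support - 1).choose k : K)) (n + 1)).trans ?_
    -- As s - 1 ≤ n, the full binomial row lies in the range; the further coefficients vanish.
    have hsub : range (#d.support - 1 + 1) ⊆ range (n + 1) := Finset.range_mono (by omega)
    have h2 := Nat.sum_range_choose (#d.support - 1)
    rw [Finset.sum_subset hsub fun k _ hk => Nat.choose_eq_zero_of_lt (by simpa using hk)] at h2
    exact_mod_cast congrArg (Nat.cast (R := K)) h2
  · simp

theorem two_smul_kFun {n : ℕ} (hn : 1 ≤ n) : (2 : K) • kFun K n = supportSeries K n := by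
  ext d
  rw [MvPowerSeries.coeff_smul, coeff_kFun K hn, coeff_supportSeries]
  split_ifs with hd
  · have hs : #d.support ≠ 0 := by
      intro h
      rw [Finset.card_eq_zero, Finsupp.support_eq_empty] at h
      simp [h] at hd
      omega
    rw [mul_pow_sub_one hs]
  · simp

end Hooks

end DoublySymmetric

theorem corollary3p8 (K : Type*) [Field K] [CharZero K] (n : ℕ) (hn : 1 ≤ n) :
    DoublySymmetric.kFun K n =
      ∑ lam ∈ Nat.Partition.odds n,
        ((2 : K) ^ (Multiset.card lam.parts - 1) * (DoublySymmetric.zPart lam : K)⁻¹) •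
          DoublySymmetric.powerSumPart K lam := by
  refine smul_right_injective _ (two_ne_zero (α := K)) ?_
  exact (DoublySymmetric.two_smul_kFun K hn).trans (DoublySymmetric.two_smul_sum_odds K hn).symm
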